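/- Let $H$ be the real Hilbert space of $2\pi$-periodic vector fields $u:\mathbb{R}^2\to\mathbb{R}^2$, $u(x)=\sum_{k\in\mathbb{Z}^2\setminus\{0\}}\hat u(k)e^{ik\cdot x}$, with $\hat u(k)\in\mathbb{C}^2$, $\hat u(-k)=\hat u(k)^*$, $k\cdot\hat u(k)=0$ and $\sum_k|\hat u(k)|^2<\infty$, with scalar product $(u,v)=\int_{[0,2\pi]^2}u\cdot v\,dx$ and norm $|u|=(u,u)^{1/2}$. For real $s$ let $(A^su)^{\wedge}(k)=(k\cdot k)^s\hat u(k)$ with $D(A^s)=\{u\in H:\sum_k(k\cdot k)^{2s}|\hat u(k)|^2<\infty\}$; thus $A=A^1$ is the Stokes operator. Put $\|u\|=|A^{1/2}u|$ for $u\in D(A^{1/2})$. For $u,v\in D(A)$ let $B(u,v)\in H$ be given by $$\hat B(u,v)(k)=i\sum_{j\in\mathbb{Z}^2\setminus\{0\}}\Big[(\hat u(k-j)\cdot j)\,\hat v(j)-\frac{(\hat u(k-j)\cdot j)(\hat v(j)\cdot k)}{k\cdot k}\,k\Big],\qquad k\neq 0 .$$ Let $E_\mu$ denote the orthogonal projector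 of $H$ onto the eigenspace of $A$ for $\mu$. Let $g\in D(A)$, $g\ne 0$, satisfy $Ag=\lambda g$ with $\lambda>1$, and put $G=|g|$. A (global) solution of the Navier–Stokes equation is a map $u:\mathbb{R}\to H$ with values in $D(A)$, differentiable in $H$, with $\frac{du}{dt}+Au+B(u,u)=g$ for all $t\in\mathbb{R}$. The global attractor $\mathcal{A}$ is the set of all $u_0\in H$ such that $u_0=v(0)$ for some global solution $v$ that is bounded in $H$. A ghost solution is a non-constant global solution $u$ with $u(t)\in\mathcal{A}$ for all $t$ and $\frac{d}{dt}|u(t)|^2=\frac{d}{dt}\|u(t)\|^2=0$ for all $t\in\mathbb{R}$. A ghost solution is chained, with coefficients $\alpha,\beta,\gamma\in\mathbb{R}$ independent of time, if $u(t)\in D(A^2)$ and $A^2u(t)=\gamma g+\beta u(t)+\alpha Au(t)$ for all $t\in\mathbb{R}$. Theorem. Let $u$ be a chained ghost solution with coefficients $\alpha,\beta,\gamma$. Then the polynomial $\mu^2-\alpha\mu-\beta$ has two distinct real roots $\mu_-,\mu_+$; both are eigenvalues of $A$, and $\mu_-<\lambda<\mu_+$. The quantities $E=\|u(t)\|^2$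 and $P=|Au(t)|^2$ do not depend on $t$. With $u_\pm(t)=E_{\mu_\pm}u(t)$, so that $Au_\pm(t)=\mu_\pm u_\pm(t)$, one has for all $t\in\mathbb{R}$ $$u(t)=u_+(t)+u_-(t)+\frac{E}{G^2}\,g,$$ $$|u_+(t)|^2=\frac{\lambda-\mu_-}{\mu_+(\mu_+-\mu_-)}\,E\Big(1-\frac{P}{G^2}\Big),\qquad |u_-(t)|^2=\frac{\lambda-\mu_+}{\mu_-(\mu_--\mu_+)}\,E\Big(1-\frac{P}{G^2}\Big).$$ -/

import Mathlib

open scoped ComplexConjugate ENNReal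

noncomputable section

namespace NSE

/-- Wave vectors `k ∈ ℤ²`. -/
abbrev Wave : Type := Fin 2 → ℤ

/-- Square-summable families of `ℂ²`-valued Fourier coefficients. -/
abbrev Coeffs : Type := lp (fun _ : Wave => EuclideanSpace ℂ (Fin 2)) 2

/-- `k · k` as a real number. -/
def normSq (k : Wave) : ℝ := ∑ i, (k i : ℝ) ^ 2

/-- The bilinear (unconjugated) product `a · k` of a vector `a ∈ ℂ²` and a wave vector. -/
def dotWave (a : EuclideanSpace ℂ (Fin 2)) (k : Wave) : ℂ := ∑ i, a i * (k i : ℂ)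

/-- The real phase space `H` of `2π`-periodic, `ℝ²`-valued, divergence-free `L²` fields of mean
zero. The field `u(x) = ∑ₖ û(k) exp(i k · x)` is given by its Fourier coefficients: `û(0) = 0`
(mean zero), `û(-k) = û(k)*` (real values), and `û(k) · k = 0` (zero divergence). -/
def H : Submodule ℝ Coeffs where
  carrier := {u | u 0 = 0 ∧ (∀ k i, u (-k) i = conj (u k i)) ∧ ∀ k, dotWave (u k) k = 0}
  zero_mem' := by
    refine ⟨by simp, fun k i => by simp, fun k => by simp [dotWave]⟩
  add_mem' := by
    rintro u v ⟨hu0, hu1, hu2⟩ ⟨hv0, hv1, hv2⟩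
    refine ⟨by simp [hu0, hv0], fun k i => by simp [hu1, hv1], fun k => ?_⟩
    have h1 := hu2 k
    have h2 := hv2 k
    simp only [dotWave, lp.coeFn_add, Pi.add_apply, PiLp.add_apply, add_mul,
      Finset.sum_add_distrib] at h1 h2 ⊢
    rw [h1, h2, add_zero]
  smul_mem' := by
    rintro c u ⟨hu0, hu1, hu2⟩
    refine ⟨by simp [hu0], fun k i => by simp [hu1], fun k => ?_⟩
    have h1 := hu2 k
    simp only [dotWave, lp.coeFn_smul, Pi.smul_apply, PiLp.smul_apply, smul_mul_assoc,
      ← Finset.smul_sum] at h1 ⊢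
    rw [h1, smul_zero]

/-- The Fourier coefficient `û(k)`. -/
def hat (u : H) (k : Wave) : EuclideanSpace ℂ (Fin 2) := (u : Coeffs) k

/-- The `L²` scalar product `(u, v) = ∫ u · v dx` over `[0, 2π]²`, which by Parseval's identity
is `(2π)² ∑ₖ û(k) · v̂(k)*`. -/
def ip (u v : H) : ℝ :=
  (2 * Real.pi) ^ 2 * ∑' k : Wave, ∑ i, (hat u k i * conj (hat v k i)).re

/-- The `L²` norm `|u| = (u, u)^{1/2}`. -/
def hNorm (u : H) : ℝ := √(ip u u)

theorem normSq_nonneg (k : Wave) : 0 ≤ normSq k :=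
  Finset.sum_nonneg fun _ _ => sq_nonneg _

theorem normSq_neg (k : Wave) : normSq (-k) = normSq k := by simp [normSq]

/-- The element of `H` with coefficients `m(k) û(k)`, for an even real multiplier `m` such that
these coefficients are square-summable. -/
def mulH (m : Wave → ℝ) (hm : ∀ k, m (-k) = m k) (u : H)
    (h : Memℓp (fun k => m k • hat u k) 2) : H :=
  ⟨⟨fun k => m k • hat u k, h⟩, by
    obtain ⟨u, hu0, hu1, hu2⟩ := u
    refine ⟨?_, fun k i => ?_, fun k => ?_⟩
    · simp [hat, hu0]
    · simp [hat, hu1, hm]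
    · have h1 := hu2 k
      simp only [dotWave, hat, PiLp.smul_apply, smul_mul_assoc, ← Finset.smul_sum] at h1 ⊢
      rw [h1, smul_zero]⟩

/-- The domain `D(A^s)`: all `u ∈ H` for which the family `(k · k)^s û(k)` is square-summable. -/
def powDomain (s : ℝ) : Submodule ℝ H where
  carrier := {u | Memℓp (fun k => (normSq k ^ s) • hat u k) 2}
  zero_mem' := by
    have : (fun k : Wave => (normSq k ^ s) • hat (0 : H) k) = 0 := by
      funext k; simp [hat]
    simp only [Set.mem_ofPred_eq, this]
    exact zero_memℓp
  add_mem' := by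
    intro u v hu hv
    have : (fun k : Wave => (normSq k ^ s) • hat (u + v) k)
        = (fun k => (normSq k ^ s) • hat u k) + fun k => (normSq k ^ s) • hat v k := by
      funext k; simp [hat]
    simp only [Set.mem_ofPred_eq, this]
    exact Memℓp.add hu hv
  smul_mem' := by
    intro c u hu
    have : (fun k : Wave => (normSq k ^ s) • hat (c • u) k)
        = c • fun k => (normSq k ^ s) • hat u k := by
      funext k; simp [hat, smul_comm c]
    simp only [Set.mem_ofPred_eq, this]
    exact Memℓp.const_smul hu c

/-- The power `A^s` of the Stokes operator, `(A^s u)^(k) = (k · k)^s û(k)`, as an unbounded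
operator on `H` with domain `D(A^s)`. -/
def stokesPow (s : ℝ) : H →ₗ.[ℝ] H where
  domain := powDomain s
  toFun :=
    { toFun := fun u => mulH (fun k => normSq k ^ s) (fun k => by rw [normSq_neg]) u.1 u.2
      map_add' := by
        intro u v
        apply Subtype.ext; apply Subtype.ext; funext k
        exact smul_add (normSq k ^ s) (hat u.1 k) (hat v.1 k)
      map_smul' := by
        intro c u
        apply Subtype.ext; apply Subtype.ext; funext k
        exact smul_comm (normSq k ^ s) c (hat u.1 k) }

/-- The Stokes operator `A`. -/
def stokes : H →ₗ.[ℝ] H := stokesPow 1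

/-- `D(A) ⊆ V = D(A^{1/2})`. -/
theorem stokes_domain_le : stokes.domain ≤ (stokesPow (1 / 2)).domain := by
  intro u hu
  have hu' : Memℓp (fun k => (normSq k ^ (1 : ℝ)) • hat u k) 2 := hu
  change Memℓp (fun k => (normSq k ^ (1 / 2 : ℝ)) • hat u k) 2
  refine Memℓp.mono' hu' fun k => ?_
  rw [norm_smul, norm_smul]
  refine mul_le_mul_of_nonneg_right ?_ (norm_nonneg _)
  rw [Real.norm_of_nonneg (Real.rpow_nonneg (normSq_nonneg k) _),
    Real.norm_of_nonneg (Real.rpow_nonneg (normSq_nonneg k) _)]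
  by_cases hk : k = 0
  · subst hk
    simp [normSq]
  · have h1 : 1 ≤ normSq k := by
      obtain ⟨i, hi⟩ : ∃ i, k i ≠ 0 := by
        by_contra hcon
        exact hk (funext fun i => not_not.1 fun h => hcon ⟨i, h⟩)
      have h2 : (1 : ℤ) ≤ k i ^ 2 := by
        have : 0 < k i ^ 2 := by positivity
        omega
      have h3 : (1 : ℝ) ≤ (k i : ℝ) ^ 2 := by exact_mod_cast h2
      exact h3.trans (Finset.single_le_sum (f := fun i => (k i : ℝ) ^ 2)
        (fun _ _ => sq_nonneg _) (Finset.mem_univ i))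
    exact Real.rpow_le_rpow_of_exponent_le h1 (by norm_num)

/-- The norm `‖u‖ = |A^{1/2} u|` on `V = D(A^{1/2})`. -/
def vNorm (u : (stokesPow (1 / 2)).domain) : ℝ := hNorm (stokesPow (1 / 2) u)

/-- `μ` is an eigenvalue of `A` (the spectrum of `A` consists of its eigenvalues). -/
def IsEigenvalue (μ : ℝ) : Prop :=
  ∃ v : stokes.domain, (v : H) ≠ 0 ∧ stokes v = μ • (v : H)

/-- The projector `E_μ` of `H` onto the eigenspace of `A` for `μ`: it keeps the Fourier modes
with `k · k = μ` and removes the others. -/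
def eigProj (μ : ℝ) (u : H) : H :=
  mulH (fun k => Set.indicator {k | normSq k = μ} 1 k)
    (fun k => by
      by_cases h : normSq k = μ <;> simp [Set.indicator, normSq_neg, h])
    u (by
      refine Memℓp.mono' (lp.memℓp (u : Coeffs)) fun k => ?_
      by_cases h : normSq k = μ <;> simp [Set.indicator, h, hat])

/-- The Fourier coefficients of the bilinear map `B(u, v)`,
`i ∑ⱼ [(û(k-j) · j) v̂(j) - ((û(k-j) · j) (v̂(j) · k) / (k · k)) k]` for `k ≠ 0`.
(The term `j = 0` vanishes because `v̂(0) = 0`.) -/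
def bilinCoeff (u v : H) (k : Wave) (i : Fin 2) : ℂ :=
  Complex.I * ∑' j : Wave,
    (dotWave (hat u (k - j)) j * hat v j i
      - dotWave (hat u (k - j)) j * dotWave (hat v j) k / (normSq k : ℂ) * (k i : ℂ))

/-- `b = B(u, v)` as an element of `H`. -/
def IsBilin (u v b : H) : Prop :=
  ∀ k : Wave, k ≠ 0 → ∀ i, hat b k i = bilinCoeff u v k i

/-- `u : ℝ → H` is a solution, for all times, of `du/dt + A u + B(u, u) = g`. -/
structure IsSolution (g : H) (u : ℝ → H) : Prop where
  mem_domain : ∀ t, u t ∈ stokes.domain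
  eqn : ∀ t, ∃ b : H, IsBilin (u t) (u t) b ∧
    HasDerivAt u (g - stokes ⟨u t, mem_domain t⟩ - b) t

/-- The global attractor: all `u₀ ∈ H` through which there passes a solution that is defined for
all times and bounded in `H`. -/
def attractor (g : H) : Set H :=
  {u₀ | ∃ v : ℝ → H, IsSolution g v ∧ v 0 = u₀ ∧ ∃ C : ℝ, ∀ t, hNorm (v t) ≤ C}

/-- A ghost solution: a nonstationary solution in the global attractor along which the energy
`e = |u|²` and the enstrophy `E = ‖u‖²` have zero time derivative. -/
structure IsGhost (g : H) (u : ℝ → H) : Prop where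
  sol : IsSolution g u
  mem_attractor : ∀ t, u t ∈ attractor g
  nonstationary : ∃ s t, u s ≠ u t
  energy : ∀ t, HasDerivAt (fun s => hNorm (u s) ^ 2) 0 t
  enstrophy : ∀ t, HasDerivAt
    (fun s => vNorm ⟨u s, stokes_domain_le (sol.mem_domain s)⟩ ^ 2) 0 t

/-- A chained ghost solution with (time-independent) coefficients `α`, `β`, `γ`: a ghost solution
with `A² u(t) = γ g + β u(t) + α A u(t)` for all `t`. -/
structure IsChainedGhost (g : H) (u : ℝ → H) (α β γ : ℝ) : Prop where
  ghost : IsGhost g u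
  chain : ∀ t, ∃ h : u t ∈ (stokesPow 2).domain,
    stokesPow 2 ⟨u t, h⟩ =
      γ • g + β • u t + α • stokes ⟨u t, ghost.sol.mem_domain t⟩

end NSE

end

/-! Compare the chain relation with the balance laws, mode by mode. In two dimensions each
coefficient of a divergence-free field is a complex scalar ψ(k) times k^⊥, so everything is computed
with these scalars. Since Ag = λg, the chain relation reads p(|k|²)ψ_u(k) = γψ_g(k) with p(μ) = μ² -
αμ - β, so u lives on the finitely many k ≠ 0 with p(|k|²) = 0 or |k|² = λ; all sums are therefore
finite.

The nonlinear term is orthogonal to u and to Au (`sum_bilin_energy`, `sum_bilin_enstrophy`).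
Constancy of |u|² and ‖u‖² thus gives (g,u) = ‖u‖² and (g,Au) = |Au|², whence |Au|² = λ‖u‖²
(`IsGhost.palinstrophy_eq`), that is, Σ |k|⁴(|k|² - λ)|ψ_u(k)|² = 0. A ghost solution cannot stay in
the eigenspace of λ (`IsGhost.exists_stream_ne_zero`), so at some time this sum has terms of both
signs. Active modes thus exist with |k|² below and above λ, and their values of |k|² are the two
roots of p.

Hence p(λ) ≠ 0, and the λ-component of u is κg with the constant κ = γ/p(λ). Then E = (g,u) = κG²
and P = λE. The definition of E and the relation P = λE are two linear equations for |u₊|² and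
|u₋|², which `amplitude_formula` solves. -/

noncomputable section

namespace NSE

/-! ### Scalar stream coordinates -/

/-- The coefficient of `û(k)` along `k^⊥ = (-k₂, k₁)`; up to a constant factor this is the Fourier
coefficient of the stream function. -/
def stream (u : H) (k : Wave) : ℂ :=
  (hat u k 1 * (k 0 : ℂ) - hat u k 0 * (k 1 : ℂ)) / (normSq k : ℂ)

/-- The planar cross product `k × j`. -/
def cross (k j : Wave) : ℂ := (k 0 : ℂ) * (j 1 : ℂ) - (k 1 : ℂ) * (j 0 : ℂ)

/-- The dot product `j · k` as a complex number. -/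
def dotp (j k : Wave) : ℂ := (j 0 : ℂ) * (k 0 : ℂ) + (j 1 : ℂ) * (k 1 : ℂ)

theorem normSq_eq (k : Wave) : normSq k = (k 0 : ℝ) ^ 2 + (k 1 : ℝ) ^ 2 := by
  simp [normSq, Fin.sum_univ_two]

theorem normSq_eq_zero {k : Wave} : normSq k = 0 ↔ k = 0 := by
  constructor
  · intro h
    rw [normSq_eq] at h
    have h0 : (k 0 : ℝ) = 0 := by nlinarith [sq_nonneg (k 0 : ℝ), sq_nonneg (k 1 : ℝ)]
    have h1 : (k 1 : ℝ) = 0 := by nlinarith [sq_nonneg (k 0 : ℝ), sq_nonneg (k 1 : ℝ)]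
    funext i
    fin_cases i
    · exact_mod_cast h0
    · exact_mod_cast h1
  · rintro rfl
    simp [normSq]

theorem normSq_pos {k : Wave} (hk : k ≠ 0) : 0 < normSq k :=
  lt_of_le_of_ne (normSq_nonneg k) fun h => hk (normSq_eq_zero.1 h.symm)

theorem hat_zero_wave (u : H) : hat u 0 = 0 := u.2.1

theorem hat_neg_wave (u : H) (k : Wave) (i : Fin 2) : hat u (-k) i = conj (hat u k i) := u.2.2.1 k i

theorem div_free (u : H) (k : Wave) : hat u k 0 * (k 0 : ℂ) + hat u k 1 * (k 1 : ℂ) = 0 := by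
  have h : dotWave (hat u k) k = 0 := u.2.2.2 k
  simpa [dotWave, Fin.sum_univ_two] using h

theorem stream_zero_wave (u : H) : stream u 0 = 0 := by simp [stream]

theorem hat_eq_stream (u : H) (k : Wave) :
    hat u k 0 = -(stream u k * (k 1 : ℂ)) ∧ hat u k 1 = stream u k * (k 0 : ℂ) := by
  by_cases hk : k = 0
  · subst hk
    simp [hat_zero_wave]
  · have hq : (normSq k : ℂ) ≠ 0 := by exact_mod_cast (normSq_pos hk).ne'
    have hd := div_free u k
    have hq' : (normSq k : ℂ) = (k 0 : ℂ) ^ 2 + (k 1 : ℂ) ^ 2 := by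
      rw [normSq_eq]; push_cast; rfl
    constructor
    · rw [stream, div_mul_eq_mul_div, ← neg_div, eq_div_iff hq, hq']
      linear_combination (k 0 : ℂ) * hd
    · rw [stream, div_mul_eq_mul_div, eq_div_iff hq, hq']
      linear_combination (k 1 : ℂ) * hd

/-- The minus sign appears because k^⊥ is odd in k. -/
theorem stream_neg_wave (u : H) (k : Wave) : stream u (-k) = -conj (stream u k) := by
  simp only [stream, hat_neg_wave, normSq_neg, map_div₀, map_sub, map_mul, Complex.conj_ofReal,
    Pi.neg_apply, Int.cast_neg, map_intCast]
  ring

theorem ext_stream {u v : H} (h : ∀ k, stream u k = stream v k) : u = v := by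
  apply Subtype.ext; apply Subtype.ext; funext k
  change hat u k = hat v k
  ext i
  fin_cases i
  · change hat u k 0 = hat v k 0
    rw [(hat_eq_stream u k).1, (hat_eq_stream v k).1, h]
  · change hat u k 1 = hat v k 1
    rw [(hat_eq_stream u k).2, (hat_eq_stream v k).2, h]

theorem stream_add (u v : H) (k : Wave) : stream (u + v) k = stream u k + stream v k := by
  have h : hat (u + v) k = hat u k + hat v k := rfl
  simp only [stream, h, PiLp.add_apply]
  ring

theorem stream_smul (r : ℝ) (u : H) (k : Wave) : stream (r • u) k = r * stream u k := by
  have h : hat (r • u) k = r • hat u k := rfl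
  simp only [stream, h, PiLp.smul_apply, Complex.real_smul]
  ring

theorem stream_sub (u v : H) (k : Wave) : stream (u - v) k = stream u k - stream v k := by
  have h : hat (u - v) k = hat u k - hat v k := rfl
  simp only [stream, h, PiLp.sub_apply]
  ring

theorem stream_mulH (m : Wave → ℝ) (hm : ∀ k, m (-k) = m k) (u : H)
    (h : Memℓp (fun k => m k • hat u k) 2) (k : Wave) :
    stream (mulH m hm u h) k = m k * stream u k := by
  have h : hat (mulH m hm u h) k = m k • hat u k := rfl
  simp only [stream, h, PiLp.smul_apply, Complex.real_smul]
  ring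

theorem stream_stokesPow (s : ℝ) (u : (stokesPow s).domain) (k : Wave) :
    stream (stokesPow s u) k = ((normSq k ^ s : ℝ) : ℂ) * stream u k :=
  stream_mulH (fun k => normSq k ^ s) (fun k => by rw [normSq_neg]) _ u.2 k

theorem stream_stokes (u : stokes.domain) (k : Wave) :
    stream (stokes u) k = (normSq k : ℂ) * stream u k := by
  have h := stream_stokesPow 1 u k
  rwa [Real.rpow_one] at h

open Classical in
theorem stream_eigProj (μ : ℝ) (u : H) (k : Wave) :
    stream (eigProj μ u) k = if normSq k = μ then stream u k else 0 := by
  rw [eigProj, stream_mulH]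
  by_cases h : normSq k = μ <;> simp [Set.indicator, h]

theorem sum_hat_mul_conj (u v : H) (k : Wave) :
    ∑ i, (hat u k i * conj (hat v k i)).re = normSq k * (stream u k * conj (stream v k)).re := by
  rw [Fin.sum_univ_two, (hat_eq_stream u k).1, (hat_eq_stream u k).2, (hat_eq_stream v k).1,
    (hat_eq_stream v k).2, normSq_eq]
  simp only [map_neg, map_mul, map_intCast, Complex.mul_re, Complex.mul_im, Complex.neg_re,
    Complex.neg_im, Complex.conj_re, Complex.conj_im, Complex.intCast_re, Complex.intCast_im]
  ring

/-! ### Norms as finite sums -/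

theorem hNorm_sq_eq_sum (u : H) (S : Finset Wave) (hS : ∀ k ∉ S, stream u k = 0) :
    hNorm u ^ 2 = (2 * Real.pi) ^ 2 * ∑ k ∈ S, normSq k * ‖stream u k‖ ^ 2 := by
  have h : ip u u = (2 * Real.pi) ^ 2 * ∑ k ∈ S, normSq k * ‖stream u k‖ ^ 2 := by
    rw [ip, tsum_eq_sum (s := S)]
    · congr 1
      refine Finset.sum_congr rfl fun k _ => ?_
      rw [sum_hat_mul_conj, Complex.mul_conj, Complex.ofReal_re, Complex.normSq_eq_norm_sq]
    · intro k hk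
      rw [sum_hat_mul_conj, hS k hk]
      simp
  rw [hNorm, Real.sq_sqrt, h]
  rw [h]
  exact mul_nonneg (sq_nonneg _)
    (Finset.sum_nonneg fun k _ => mul_nonneg (normSq_nonneg k) (sq_nonneg _))

theorem vNorm_sq_eq_sum (u : (stokesPow (1 / 2)).domain) (S : Finset Wave)
    (hS : ∀ k ∉ S, stream u k = 0) :
    vNorm u ^ 2 = (2 * Real.pi) ^ 2 * ∑ k ∈ S, normSq k ^ 2 * ‖stream u k‖ ^ 2 := by
  rw [vNorm, hNorm_sq_eq_sum _ S fun k hk => by rw [stream_stokesPow, hS k hk, mul_zero]]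
  congr 1
  refine Finset.sum_congr rfl fun k _ => ?_
  rw [stream_stokesPow, norm_mul, mul_pow, Complex.norm_real, Real.norm_eq_abs, sq_abs,
    ← Real.sqrt_eq_rpow, Real.sq_sqrt (normSq_nonneg k)]
  ring

theorem hNorm_stokes_sq_eq_sum (u : stokes.domain) (S : Finset Wave)
    (hS : ∀ k ∉ S, stream u k = 0) :
    hNorm (stokes u) ^ 2 = (2 * Real.pi) ^ 2 * ∑ k ∈ S, normSq k ^ 3 * ‖stream u k‖ ^ 2 := by
  rw [hNorm_sq_eq_sum _ S fun k hk => by rw [stream_stokes, hS k hk, mul_zero]]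
  congr 1
  refine Finset.sum_congr rfl fun k _ => ?_
  rw [stream_stokes, norm_mul, mul_pow, Complex.norm_real, Real.norm_eq_abs, sq_abs]
  ring

theorem finite_normSq_le (R : ℝ) : {k : Wave | normSq k ≤ R}.Finite := by
  refine (Set.Finite.pi' fun _ : Fin 2 => Set.finite_Icc (-⌈R⌉) ⌈R⌉).subset fun k hk i => ?_
  have h1 : (k i : ℝ) ^ 2 ≤ R := (Finset.single_le_sum (f := fun i => (k i : ℝ) ^ 2)
    (fun _ _ => sq_nonneg _) (Finset.mem_univ i)).trans hk
  have h2 : k i ^ 2 ≤ ⌈R⌉ := by exact_mod_cast h1.trans (Int.le_ceil R)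
  constructor <;> nlinarith [sq_nonneg (k i - 1), sq_nonneg (k i + 1)]

/-! ### The nonlinear term -/

/-- The pressure term is parallel to k and drops out of the component along k^⊥; the transport
factor is (k-j)^⊥ · j = k × j because j^⊥ · j = 0. -/
theorem stream_bilin {u b : H} (hb : IsBilin u u b) (S : Finset Wave)
    (hS : ∀ k ∉ S, stream u k = 0) {k : Wave} (hk : k ≠ 0) :
    (normSq k : ℂ) * stream b k =
      Complex.I * ∑ j ∈ S, stream u (k - j) * stream u j * cross k j * dotp j k := by
  have hq : (normSq k : ℂ) ≠ 0 := by exact_mod_cast (normSq_pos hk).ne'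
  have hc : ∀ i, hat b k i = Complex.I * ∑ j ∈ S,
      (dotWave (hat u (k - j)) j * hat u j i
        - dotWave (hat u (k - j)) j * dotWave (hat u j) k / (normSq k : ℂ) * (k i : ℂ)) := by
    intro i
    rw [hb k hk i, bilinCoeff, tsum_eq_sum (s := S)]
    intro j hj
    have h0 : hat u j = 0 := by
      ext i
      fin_cases i
      · simpa [hS j hj] using (hat_eq_stream u j).1
      · simpa [hS j hj] using (hat_eq_stream u j).2
    simp [h0, dotWave]
  rw [stream, mul_div_cancel₀ _ hq, hc, hc, mul_assoc, mul_assoc, ← mul_sub, Finset.sum_mul,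
    Finset.sum_mul, ← Finset.sum_sub_distrib]
  congr 1
  refine Finset.sum_congr rfl fun j _ => ?_
  have hd : dotWave (hat u (k - j)) j = stream u (k - j) * cross k j := by
    rw [dotWave, Fin.sum_univ_two, (hat_eq_stream u (k - j)).1, (hat_eq_stream u (k - j)).2, cross]
    simp only [Pi.sub_apply]
    push_cast
    ring
  rw [hd, (hat_eq_stream u j).1, (hat_eq_stream u j).2, dotp]
  ring

/-- The substitution j ↦ k - j exchanges the two stream factors and reverses the sign of k × j. -/
theorem sum_stream_cross_eq_zero (u : H) (S : Finset Wave) (hS : ∀ k ∉ S, stream u k = 0)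
    (k : Wave) (m : Wave → ℂ) (hm : ∀ j, m (k - j) = m j) :
    ∑ j ∈ S, stream u (k - j) * stream u j * cross k j * m j = 0 := by
  -- The set S need not be stable under j ↦ k - j, so the substitution is made in the sum over all
  -- wave vectors.
  have hsum : ∑' j, stream u (k - j) * stream u j * cross k j * m j
      = ∑ j ∈ S, stream u (k - j) * stream u j * cross k j * m j :=
    tsum_eq_sum fun j hj => by rw [hS j hj]; ring
  rw [← hsum]
  have h := (Equiv.subLeft k).tsum_eq fun j => stream u (k - j) * stream u j * cross k j * m j
  have h' : ∀ j, stream u (k - Equiv.subLeft k j) * stream u (Equiv.subLeft k j)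
      * cross k (Equiv.subLeft k j) * m (Equiv.subLeft k j)
      = -(stream u (k - j) * stream u j * cross k j * m j) := by
    intro j
    have hx : cross k (k - j) = -cross k j := by
      simp only [cross, Pi.sub_apply]; push_cast; ring
    rw [Equiv.subLeft_apply, sub_sub_cancel, hm, hx]
    ring
  simp only [h', tsum_neg] at h
  exact self_eq_neg.1 h.symm

/-- The vorticity form of the nonlinear term. -/
theorem stream_bilin_vorticity {u b : H} (hb : IsBilin u u b) (S : Finset Wave)
    (hS : ∀ k ∉ S, stream u k = 0) {k : Wave} (hk : k ≠ 0) :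
    (normSq k : ℂ) * stream b k =
      Complex.I * ∑ j ∈ S, stream u (k - j) * stream u j * cross k j * (normSq j : ℂ) := by
  rw [stream_bilin hb S hS hk]
  congr 1
  -- The two weights differ by j · k - |j|² = j · (k - j), which is symmetric under j ↦ k - j and so
  -- contributes nothing.
  rw [← sub_eq_zero, ← Finset.sum_sub_distrib,
    ← sum_stream_cross_eq_zero u S hS k (fun j => dotp j (k - j))]
  · refine Finset.sum_congr rfl fun j _ => ?_
    simp only [dotp, normSq_eq, Pi.sub_apply]
    push_cast
    ring
  · intro j
    simp only [dotp, Pi.sub_apply]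
    push_cast
    ring

/-- In the vorticity form the weight |j|² is the constant λ on the active modes, and a constant
weight sums to zero by antisymmetry. -/
theorem bilin_eq_zero_of_eigen {u b : H} (hb : IsBilin u u b) (S : Finset Wave)
    (hS : ∀ k ∉ S, stream u k = 0) {lam : ℝ} (h : ∀ k, stream u k ≠ 0 → normSq k = lam)
    (k : Wave) : stream b k = 0 := by
  by_cases hk : k = 0
  · rw [hk, stream_zero_wave]
  have hq : (normSq k : ℂ) ≠ 0 := by exact_mod_cast (normSq_pos hk).ne'
  have h1 := stream_bilin_vorticity hb S hS hk
  have h2 := sum_stream_cross_eq_zero u S hS k (fun _ => (lam : ℂ)) fun _ => rfl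
  have h3 : ∑ j ∈ S, stream u (k - j) * stream u j * cross k j * (normSq j : ℂ) = 0 := by
    rw [← h2]
    refine Finset.sum_congr rfl fun j _ => ?_
    by_cases hj : stream u j = 0
    · rw [hj]; ring
    · rw [h j hj]
  rw [h3, mul_zero] at h1
  exact (mul_eq_zero.1 h1).resolve_left hq

/-- The involution (k, j) ↦ (-j, -k) of S × S reverses the sign of the sum. -/
theorem sum_sum_antisymm_eq_zero (S : Finset Wave) (hneg : ∀ k ∈ S, -k ∈ S)
    (F : Wave → Wave → ℂ) (hF : ∀ k j, F (-j) (-k) = -F k j) :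
    ∑ k ∈ S, ∑ j ∈ S, F k j = 0 := by
  have hs : ∀ f : Wave → ℂ, ∑ k ∈ S, f (-k) = ∑ k ∈ S, f k := fun f =>
    Finset.sum_nbij' (fun k => -k) (fun k => -k) hneg hneg (fun k _ => neg_neg k)
      (fun k _ => neg_neg k) fun _ _ => rfl
  have h : ∑ k ∈ S, ∑ j ∈ S, F k j = -∑ k ∈ S, ∑ j ∈ S, F k j := by
    calc ∑ k ∈ S, ∑ j ∈ S, F k j = ∑ j ∈ S, ∑ k ∈ S, F k j := Finset.sum_comm
      _ = ∑ j ∈ S, ∑ k ∈ S, F (-k) j := Finset.sum_congr rfl fun j _ => (hs fun k => F k j).symm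
      _ = ∑ j ∈ S, ∑ k ∈ S, F (-k) (-j) := (hs fun j => ∑ k ∈ S, F (-k) j).symm
      _ = -∑ k ∈ S, ∑ j ∈ S, F k j := by simp only [hF, Finset.sum_neg_distrib]
  exact self_eq_neg.1 h

/-- This is (B(u,u), u) = 0. Under (k, j) ↦ (-j, -k) the difference k - j, the weight j · k and, by
reality, ψ(j)ψ(k)* are preserved, while k × j changes sign. -/
theorem sum_bilin_energy {u b : H} (hb : IsBilin u u b) (S : Finset Wave) (h0 : (0 : Wave) ∉ S)
    (hneg : ∀ k ∈ S, -k ∈ S) (hS : ∀ k ∉ S, stream u k = 0) :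
    ∑ k ∈ S, normSq k * (stream b k * conj (stream u k)).re = 0 := by
  have h := sum_sum_antisymm_eq_zero S hneg
    (fun k j => Complex.I * (stream u (k - j) * stream u j * cross k j * dotp j k)
      * conj (stream u k)) fun k j => by
    simp only [stream_neg_wave, sub_neg_eq_add, neg_add_eq_sub, dotp, cross, Pi.neg_apply, map_neg,
      Complex.conj_conj]
    push_cast
    ring
  have h' : ∑ k ∈ S, (normSq k : ℂ) * (stream b k * conj (stream u k)) = 0 := by
    rw [← h]
    refine Finset.sum_congr rfl fun k hk => ?_
    rw [← mul_assoc, stream_bilin hb S hS (ne_of_mem_of_not_mem hk h0), Finset.mul_sum,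
      Finset.sum_mul]
  have h2 := congrArg Complex.re h'
  simpa only [Complex.re_sum, Complex.re_ofReal_mul, Complex.zero_re] using h2

/-- This is (B(u,u), Au) = 0, special to two dimensions: with the vorticity form the total weight is
|k|²|j|², again symmetric. -/
theorem sum_bilin_enstrophy {u b : H} (hb : IsBilin u u b) (S : Finset Wave)
    (h0 : (0 : Wave) ∉ S) (hneg : ∀ k ∈ S, -k ∈ S) (hS : ∀ k ∉ S, stream u k = 0) :
    ∑ k ∈ S, normSq k ^ 2 * (stream b k * conj (stream u k)).re = 0 := by
  have h := sum_sum_antisymm_eq_zero S hneg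
    (fun k j => (normSq k : ℂ) * (Complex.I
      * (stream u (k - j) * stream u j * cross k j * (normSq j : ℂ))) * conj (stream u k))
    fun k j => by
    simp only [stream_neg_wave, sub_neg_eq_add, neg_add_eq_sub, cross, Pi.neg_apply, map_neg,
      Complex.conj_conj, normSq_neg]
    push_cast
    ring
  have h' : ∑ k ∈ S, ((normSq k ^ 2 : ℝ) : ℂ) * (stream b k * conj (stream u k)) = 0 := by
    rw [← h]
    refine Finset.sum_congr rfl fun k hk => ?_
    rw [← Finset.sum_mul, ← Finset.mul_sum, ← Finset.mul_sum,
      ← stream_bilin_vorticity hb S hS (ne_of_mem_of_not_mem hk h0)]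
    push_cast
    ring
  have h2 := congrArg Complex.re h'
  simpa only [Complex.re_sum, Complex.re_ofReal_mul, Complex.zero_re] using h2

/-! ### Evolution of the Fourier coefficients -/

/-- The coefficient `stream · k` as a continuous linear functional. -/
def streamCLM (k : Wave) : H →L[ℝ] ℂ :=
  LinearMap.mkContinuousOfExistsBound
    { toFun := fun u => stream u k
      map_add' := fun u v => stream_add u v k
      map_smul' := fun r u => by rw [stream_smul, RingHom.id_apply, Complex.real_smul] } <| by
    refine ⟨(‖(k 0 : ℂ)‖ + ‖(k 1 : ℂ)‖) / ‖(normSq k : ℂ)‖, fun u => ?_⟩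
    change ‖stream u k‖ ≤ _
    have h : ∀ i, ‖hat u k i‖ ≤ ‖u‖ := fun i =>
      (PiLp.norm_apply_le (hat u k) i).trans (lp.norm_apply_le_norm two_ne_zero (u : Coeffs) k)
    rw [stream, norm_div, div_mul_eq_mul_div]
    gcongr
    refine (norm_sub_le _ _).trans ?_
    rw [norm_mul, norm_mul, add_mul, mul_comm, mul_comm ‖hat u k 0‖]
    gcongr
    · exact h 1
    · exact h 0

theorem hasDerivAt_stream {u : ℝ → H} {v : H} {t : ℝ} (h : HasDerivAt u v t) (k : Wave) :
    HasDerivAt (fun s => stream (u s) k) (stream v k) t :=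
  (streamCLM k).hasFDerivAt.comp_hasDerivAt t h

theorem hasDerivAt_sum_norm_sq {u : ℝ → H} {v : H} {t : ℝ} (h : HasDerivAt u v t)
    (S : Finset Wave) (w : Wave → ℝ) :
    HasDerivAt (fun s => ∑ k ∈ S, w k * ‖stream (u s) k‖ ^ 2)
      (∑ k ∈ S, w k * (2 * (stream v k * conj (stream (u t) k)).re)) t := by
  refine HasDerivAt.fun_sum fun k _ => HasDerivAt.const_mul _ ?_
  have h1 := (hasDerivAt_stream h k).norm_sq
  rwa [Complex.inner] at h1

end NSE
namespace NSE

/-! ### Balance laws -/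

/-- Differentiate the weighted sum along the equation: once the nonlinear contribution vanishes,
constancy forces forcing and dissipation to cancel. -/
theorem weighted_balance {g b : H} {u : ℝ → H} {t : ℝ} (h : u t ∈ stokes.domain)
    (hd : HasDerivAt u (g - stokes ⟨u t, h⟩ - b) t) (S : Finset Wave) (w : Wave → ℝ)
    (hb : ∑ k ∈ S, w k * (stream b k * conj (stream (u t) k)).re = 0)
    (hw : HasDerivAt (fun s => ∑ k ∈ S, w k * ‖stream (u s) k‖ ^ 2) 0 t) :
    ∑ k ∈ S, w k * (stream g k * conj (stream (u t) k)).re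
      = ∑ k ∈ S, w k * normSq k * ‖stream (u t) k‖ ^ 2 := by
  have h1 := (hasDerivAt_sum_norm_sq hd S w).unique hw
  have h2 : ∑ k ∈ S, w k * (2 * (stream (g - stokes ⟨u t, h⟩ - b) k * conj (stream (u t) k)).re)
      = 2 * (∑ k ∈ S, w k * (stream g k * conj (stream (u t) k)).re
        - ∑ k ∈ S, w k * normSq k * ‖stream (u t) k‖ ^ 2
        - ∑ k ∈ S, w k * (stream b k * conj (stream (u t) k)).re) := by
    rw [← Finset.sum_sub_distrib, ← Finset.sum_sub_distrib, Finset.mul_sum]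
    refine Finset.sum_congr rfl fun k _ => ?_
    rw [stream_sub, stream_sub, stream_stokes, sub_mul, sub_mul, mul_assoc, Complex.mul_conj,
      Complex.sub_re, Complex.sub_re, Complex.re_ofReal_mul, Complex.ofReal_re,
      Complex.normSq_eq_norm_sq]
    ring
  rw [h2, hb] at h1
  linarith

theorem IsGhost.hasDerivAt_energy_sum {g : H} {u : ℝ → H} (hu : IsGhost g u) (S : Finset Wave)
    (hS : ∀ t, ∀ k ∉ S, stream (u t) k = 0) (t : ℝ) :
    HasDerivAt (fun s => ∑ k ∈ S, normSq k * ‖stream (u s) k‖ ^ 2) 0 t := by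
  have h := (hu.energy t).const_mul ((2 * Real.pi) ^ 2)⁻¹
  simp only [fun s => hNorm_sq_eq_sum (u s) S (hS s)] at h
  have hpi : (2 * Real.pi) ^ 2 ≠ 0 := by positivity
  simpa only [inv_mul_cancel_left₀ hpi, mul_zero] using h

theorem IsGhost.hasDerivAt_enstrophy_sum {g : H} {u : ℝ → H} (hu : IsGhost g u) (S : Finset Wave)
    (hS : ∀ t, ∀ k ∉ S, stream (u t) k = 0) (t : ℝ) :
    HasDerivAt (fun s => ∑ k ∈ S, normSq k ^ 2 * ‖stream (u s) k‖ ^ 2) 0 t := by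
  have h := (hu.enstrophy t).const_mul ((2 * Real.pi) ^ 2)⁻¹
  simp only [fun s => vNorm_sq_eq_sum ⟨u s, stokes_domain_le (hu.sol.mem_domain s)⟩ S (hS s)] at h
  have hpi : (2 * Real.pi) ^ 2 ≠ 0 := by positivity
  simpa only [inv_mul_cancel_left₀ hpi, mul_zero] using h

/-- Constancy of the energy gives `(g, u) = ‖u‖²`. -/
theorem IsGhost.energy_balance {g : H} {u : ℝ → H} (hu : IsGhost g u) (S : Finset Wave)
    (h0 : (0 : Wave) ∉ S) (hneg : ∀ k ∈ S, -k ∈ S) (hS : ∀ t, ∀ k ∉ S, stream (u t) k = 0)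
    (t : ℝ) :
    ∑ k ∈ S, normSq k * (stream g k * conj (stream (u t) k)).re
      = ∑ k ∈ S, normSq k ^ 2 * ‖stream (u t) k‖ ^ 2 := by
  obtain ⟨b, hb, hd⟩ := hu.sol.eqn t
  rw [weighted_balance _ hd S normSq (sum_bilin_energy hb S h0 hneg (hS t))
    (hu.hasDerivAt_energy_sum S hS t)]
  exact Finset.sum_congr rfl fun k _ => by ring

/-- Constancy of the enstrophy gives `(g, Au) = |Au|²`. -/
theorem IsGhost.enstrophy_balance {g : H} {u : ℝ → H} (hu : IsGhost g u) (S : Finset Wave)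
    (h0 : (0 : Wave) ∉ S) (hneg : ∀ k ∈ S, -k ∈ S) (hS : ∀ t, ∀ k ∉ S, stream (u t) k = 0)
    (t : ℝ) :
    ∑ k ∈ S, normSq k ^ 2 * (stream g k * conj (stream (u t) k)).re
      = ∑ k ∈ S, normSq k ^ 3 * ‖stream (u t) k‖ ^ 2 := by
  obtain ⟨b, hb, hd⟩ := hu.sol.eqn t
  rw [weighted_balance _ hd S (fun k => normSq k ^ 2) (sum_bilin_enstrophy hb S h0 hneg (hS t))
    (hu.hasDerivAt_enstrophy_sum S hS t)]
  exact Finset.sum_congr rfl fun k _ => by ring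

theorem normSq_eq_or_stream_eq_zero {g : H} {hg : g ∈ stokes.domain} {lam : ℝ}
    (hAg : stokes ⟨g, hg⟩ = lam • g) (k : Wave) :
    normSq k = lam ∨ stream g k = 0 := by
  have h := stream_stokes ⟨g, hg⟩ k
  rw [hAg, stream_smul] at h
  rcases mul_eq_mul_right_iff.1 h with h | h
  · left; exact_mod_cast h.symm
  · exact Or.inr h

/-- Since Ag = λg, (g, Au) = λ(g, u); the two balance laws turn this into |Au|² = λ‖u‖². -/
theorem IsGhost.palinstrophy_eq {g : H} {hg : g ∈ stokes.domain} {lam : ℝ}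
    (hAg : stokes ⟨g, hg⟩ = lam • g) {u : ℝ → H} (hu : IsGhost g u) (S : Finset Wave)
    (h0 : (0 : Wave) ∉ S) (hneg : ∀ k ∈ S, -k ∈ S) (hS : ∀ t, ∀ k ∉ S, stream (u t) k = 0)
    (t : ℝ) :
    ∑ k ∈ S, normSq k ^ 3 * ‖stream (u t) k‖ ^ 2
      = lam * ∑ k ∈ S, normSq k ^ 2 * ‖stream (u t) k‖ ^ 2 := by
  rw [← hu.enstrophy_balance S h0 hneg hS, ← hu.energy_balance S h0 hneg hS, Finset.mul_sum]
  refine Finset.sum_congr rfl fun k _ => ?_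
  rcases normSq_eq_or_stream_eq_zero hAg k with h | h
  · rw [h]; ring
  · rw [h]; simp

/-- No ghost solution stays in the eigenspace of the force. -/
theorem IsGhost.exists_stream_ne_zero {g : H} {u : ℝ → H} (hu : IsGhost g u) {lam : ℝ}
    (hlam : 0 < lam) (S : Finset Wave) (h0 : (0 : Wave) ∉ S) (hneg : ∀ k ∈ S, -k ∈ S)
    (hS : ∀ t, ∀ k ∉ S, stream (u t) k = 0) :
    ∃ t k, stream (u t) k ≠ 0 ∧ normSq k ≠ lam := by
  by_contra! hcon
  have hA : ∀ t k, (normSq k : ℂ) * stream (u t) k = lam * stream (u t) k := fun t k => by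
    by_cases hk : stream (u t) k = 0
    · rw [hk]; simp
    · rw [hcon t k hk]
  -- Inside the eigenspace the nonlinear term vanishes and the equation becomes du/dt = g - λu.
  have hder : ∀ t k, HasDerivAt (fun s => stream (u s) k) (stream g k - lam * stream (u t) k) t := by
    intro t k
    obtain ⟨b, hb, hd⟩ := hu.sol.eqn t
    have h := hasDerivAt_stream hd k
    rwa [stream_sub, stream_sub, stream_stokes,
      bilin_eq_zero_of_eigen hb S (hS t) (hcon t), hA, sub_zero] at h
  have hbal := hu.energy_balance S h0 hneg hS
  have hens : ∀ t, ∑ k ∈ S, normSq k ^ 2 * ‖stream (u t) k‖ ^ 2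
      = lam * ∑ k ∈ S, normSq k * ‖stream (u t) k‖ ^ 2 := by
    intro t
    rw [Finset.mul_sum]
    refine Finset.sum_congr rfl fun k _ => ?_
    by_cases hk : stream (u t) k = 0
    · rw [hk]; simp
    · rw [hcon t k hk]; ring
  -- `(g, u)` is constant, hence `(g, g - λ u) = 0`
  have hgu : ∀ t, ∑ k ∈ S, normSq k * (stream g k * conj (stream g k - lam * stream (u t) k)).re
      = 0 := by
    intro t
    have h1 : HasDerivAt (fun s => ∑ k ∈ S, normSq k * (stream g k * conj (stream (u s) k)).re)
        (∑ k ∈ S, normSq k * (stream g k * conj (stream g k - lam * stream (u t) k)).re) t := by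
      refine HasDerivAt.fun_sum fun k _ => HasDerivAt.const_mul _ ?_
      have h2 := ((hder t k).star.const_mul (stream g k))
      exact (Complex.reCLM.hasFDerivAt.comp_hasDerivAt t h2)
    refine h1.unique ?_
    simp only [hbal]
    exact hu.hasDerivAt_enstrophy_sum S hS t
  have hzero : ∀ t k, k ∈ S → stream g k - lam * stream (u t) k = 0 := by
    intro t
    have h3 : ∑ k ∈ S, normSq k * ‖stream g k - lam * stream (u t) k‖ ^ 2 = 0 := by
      have h4 := hgu t
      -- This is λ(u, g - λu) = 0, from (g,u) = ‖u‖² = λ|u|². Subtracted from (g, g - λu) = 0 it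
      -- leaves |g - λu|² = 0, so u is the steady state g/λ.
      have h5 : lam * (∑ k ∈ S, normSq k * (stream g k * conj (stream (u t) k)).re
          - lam * ∑ k ∈ S, normSq k * ‖stream (u t) k‖ ^ 2) = 0 := by
        rw [hbal, hens]; ring
      rw [Finset.mul_sum, ← Finset.sum_sub_distrib, Finset.mul_sum] at h5
      rw [← sub_zero (0 : ℝ)]
      nth_rw 1 [← h4]
      rw [← h5, ← Finset.sum_sub_distrib]
      refine Finset.sum_congr rfl fun k _ => ?_
      rw [← Complex.normSq_eq_norm_sq, ← Complex.normSq_eq_norm_sq]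
      simp only [Complex.normSq_apply, Complex.mul_re, Complex.mul_im, Complex.sub_re,
        Complex.sub_im, Complex.conj_re, Complex.conj_im, Complex.ofReal_re, Complex.ofReal_im]
      ring
    intro k hk
    have h6 := (Finset.sum_eq_zero_iff_of_nonneg fun k _ =>
      mul_nonneg (normSq_nonneg k) (sq_nonneg _)).1 h3 k hk
    have hq := normSq_pos (ne_of_mem_of_not_mem hk h0)
    simpa [hq.ne'] using h6
  obtain ⟨s, t, hst⟩ := hu.nonstationary
  refine hst (ext_stream fun k => ?_)
  by_cases hk : k ∈ S
  · have h7 : (lam : ℂ) * stream (u s) k = lam * stream (u t) k := by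
      linear_combination hzero t k hk - hzero s k hk
    exact mul_left_cancel₀ (by exact_mod_cast hlam.ne') h7
  · rw [hS s k hk, hS t k hk]

/-! ### Chained ghost solutions -/

theorem IsChainedGhost.chain_stream {g : H} {u : ℝ → H} {α β γ : ℝ}
    (hu : IsChainedGhost g u α β γ) (t : ℝ) (k : Wave) :
    ((normSq k ^ 2 - α * normSq k - β : ℝ) : ℂ) * stream (u t) k = γ * stream g k := by
  obtain ⟨h, he⟩ := hu.chain t
  have h1 := stream_stokesPow 2 ⟨u t, h⟩ k
  rw [he, stream_add, stream_add, stream_smul, stream_smul, stream_smul, stream_stokes,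
    Real.rpow_two] at h1
  push_cast at h1 ⊢
  linear_combination -h1

/-- This finite set carries both u(t) and g for all times, which makes every later sum finite. -/
theorem exists_modes (α β lam : ℝ) : ∃ S : Finset Wave, ∀ k, k ∈ S ↔
    k ≠ 0 ∧ (normSq k ^ 2 - α * normSq k - β = 0 ∨ normSq k = lam) := by
  have hfin : {k : Wave | k ≠ 0 ∧
      (normSq k ^ 2 - α * normSq k - β = 0 ∨ normSq k = lam)}.Finite := by
    -- Beyond 1 + |α| + |β| the quadratic is strictly positive; |λ| is added to cover the modes of
    -- the force.
    refine (finite_normSq_le (|α| + |β| + 1 + |lam|)).subset ?_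
    rintro k ⟨-, hk | hk⟩
    · change normSq k ≤ _
      by_contra! hlt
      have ha := le_abs_self α
      have hb := le_abs_self β
      have hc := abs_nonneg lam
      have ha' := abs_nonneg α
      have hb' := abs_nonneg β
      nlinarith
    · change normSq k ≤ _
      have := le_abs_self lam
      have ha' := abs_nonneg α
      have hb' := abs_nonneg β
      linarith
  exact ⟨hfin.toFinset, fun k => by simp⟩

theorem exists_stream_ne_zero_of_ne_zero {g : H} (hg : g ≠ 0) : ∃ k, stream g k ≠ 0 := by
  by_contra! h
  exact hg (ext_stream fun k => by rw [h k]; simp [stream, hat])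

theorem stokes_eigProj (μ : ℝ) (u : H) : ∃ h : eigProj μ u ∈ stokes.domain,
    stokes ⟨eigProj μ u, h⟩ = μ • eigProj μ u := by
  classical
  have hm : eigProj μ u ∈ stokes.domain := by
    change Memℓp (fun k => (normSq k ^ (1 : ℝ)) • hat (eigProj μ u) k) 2
    have he : (fun k => (normSq k ^ (1 : ℝ)) • hat (eigProj μ u) k)
        = μ • ((eigProj μ u : Coeffs) : Wave → EuclideanSpace ℂ (Fin 2)) := by
      funext k
      change (normSq k ^ (1 : ℝ)) • (Set.indicator {k | normSq k = μ} 1 k : ℝ) • hat u k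
        = μ • (Set.indicator {k | normSq k = μ} 1 k : ℝ) • hat u k
      by_cases h : normSq k = μ
      · rw [Real.rpow_one, h]
      · simp [Set.indicator, h]
    rw [he]
    exact (lp.memℓp (eigProj μ u : Coeffs)).const_smul μ
  refine ⟨hm, ext_stream fun k => ?_⟩
  rw [stream_stokes, stream_smul, stream_eigProj]
  split_ifs with h
  · rw [h]
  · simp

theorem isEigenvalue_of_stream_ne_zero {u : H} {k : Wave} (h : stream u k ≠ 0) :
    IsEigenvalue (normSq k) := by
  classical
  obtain ⟨hm, he⟩ := stokes_eigProj (normSq k) u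
  refine ⟨⟨_, hm⟩, fun h0 => h ?_, he⟩
  have h1 := stream_eigProj (normSq k) u k
  rw [if_pos rfl] at h1
  rw [← h1]
  change stream (eigProj (normSq k) u) k = 0
  rw [show eigProj (normSq k) u = 0 from h0]
  simp [stream, hat]

/-- The wave numbers of a chained ghost solution on both sides of the wave number of the force. -/
theorem IsChainedGhost.exists_modes_lt_gt {g : H} {hg : g ∈ stokes.domain} {lam : ℝ}
    (hlam : 0 < lam) (hAg : stokes ⟨g, hg⟩ = lam • g) {u : ℝ → H} {α β γ : ℝ}
    (hu : IsChainedGhost g u α β γ) {S : Finset Wave}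
    (h0 : (0 : Wave) ∉ S) (hneg : ∀ k ∈ S, -k ∈ S) (huS : ∀ t, ∀ k ∉ S, stream (u t) k = 0) :
    ∃ t km kp, stream (u t) km ≠ 0 ∧ stream (u t) kp ≠ 0 ∧ normSq km < lam ∧ lam < normSq kp := by
  obtain ⟨t, k, hk, hkl⟩ := hu.ghost.exists_stream_ne_zero hlam S h0 hneg huS
  -- This is |Au|² - λ‖u‖² = 0 up to a constant factor; a vanishing sum with a nonzero term has
  -- terms of both signs.
  have hsum : ∑ k ∈ S, normSq k ^ 2 * (normSq k - lam) * ‖stream (u t) k‖ ^ 2 = 0 := by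
    have h := hu.ghost.palinstrophy_eq hAg S h0 hneg huS t
    rw [← sub_eq_zero, Finset.mul_sum, ← Finset.sum_sub_distrib] at h
    rw [← h]
    exact Finset.sum_congr rfl fun k _ => by ring
  have hkS : k ∈ S := by
    by_contra h
    exact hk (huS t k h)
  have hne : normSq k ^ 2 * (normSq k - lam) * ‖stream (u t) k‖ ^ 2 ≠ 0 := by
    have h1 := (normSq_pos (ne_of_mem_of_not_mem hkS h0)).ne'
    have h2 := sub_ne_zero.2 hkl
    have h3 := norm_ne_zero_iff.2 hk
    positivity
  have key : ∀ {k : Wave} {x : ℝ}, normSq k ^ 2 * x * ‖stream (u t) k‖ ^ 2 ≠ 0 →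
      stream (u t) k ≠ 0 := fun {k x} h h' => h (by rw [h']; simp)
  obtain ⟨kp, -, hp⟩ := Finset.exists_pos_of_sum_zero_of_exists_nonzero _ hsum ⟨k, hkS, hne⟩
  obtain ⟨km, -, hm⟩ := Finset.exists_pos_of_sum_zero_of_exists_nonzero
    (fun k => -(normSq k ^ 2 * (normSq k - lam) * ‖stream (u t) k‖ ^ 2))
    (by rw [Finset.sum_neg_distrib, hsum, neg_zero]) ⟨k, hkS, neg_ne_zero.2 hne⟩
  refine ⟨t, km, kp, key (x := normSq km - lam) (by linarith : _ < (0 : ℝ)).ne,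
    key (x := normSq kp - lam) hp.ne', ?_, ?_⟩
  · by_contra! h
    have : 0 ≤ normSq km ^ 2 * (normSq km - lam) * ‖stream (u t) km‖ ^ 2 :=
      mul_nonneg (mul_nonneg (sq_nonneg _) (sub_nonneg.2 h)) (sq_nonneg _)
    linarith
  · by_contra! h
    have : 0 ≤ normSq kp ^ 2 * (lam - normSq kp) * ‖stream (u t) kp‖ ^ 2 :=
      mul_nonneg (mul_nonneg (sq_nonneg _) (sub_nonneg.2 h)) (sq_nonneg _)
    linarith

/-- The modes of a chained ghost solution that the force does not excite lie at roots of the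
characteristic polynomial. -/
theorem IsChainedGhost.root_of_stream_ne_zero {g : H} {hg : g ∈ stokes.domain} {lam : ℝ}
    (hAg : stokes ⟨g, hg⟩ = lam • g) {u : ℝ → H} {α β γ : ℝ}
    (hu : IsChainedGhost g u α β γ) {t : ℝ} {k : Wave} (hk : stream (u t) k ≠ 0)
    (hkl : normSq k ≠ lam) : normSq k ^ 2 - α * normSq k - β = 0 := by
  have h := hu.chain_stream t k
  rw [(normSq_eq_or_stream_eq_zero hAg k).resolve_left hkl, mul_zero] at h
  exact_mod_cast (mul_eq_zero.1 h).resolve_right hk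

theorem amplitude_formula {μm μp lam E X a b : ℝ} (hm : 0 < μm) (hml : μm < lam) (hlp : lam < μp)
    (hE : μp * a + μm * b = E * X)
    (hP : μp * (μp - lam) * a + μm * (μm - lam) * b = 0) :
    a = (lam - μm) / (μp * (μp - μm)) * E * X ∧ b = (lam - μp) / (μm * (μm - μp)) * E * X := by
  have h1 : μp ≠ 0 := by linarith
  have h2 : μp - μm ≠ 0 := by linarith
  have h3 : μm - μp ≠ 0 := by linarith
  constructor
  · rw [mul_assoc, ← hE]
    field_simp
    linear_combination hP
  · rw [mul_assoc, ← hE]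
    field_simp
    linear_combination hP

end NSE
end

namespace NSE

/-! ### Splitting into three eigencomponents -/

-- The constant is γ/p(λ): at |k|² = λ the chain relation reads p(λ)ψ_u = γψ_g with p(λ) ≠ 0.
-- Elsewhere ψ_g = 0, so only roots of p survive.
open Classical in
theorem IsChainedGhost.stream_decomp {g : H} {hg : g ∈ stokes.domain} {lam : ℝ}
    (hAg : stokes ⟨g, hg⟩ = lam • g) {u : ℝ → H} {α β γ : ℝ}
    (hu : IsChainedGhost g u α β γ) {μm μp : ℝ}
    (hp : ∀ x : ℝ, x ^ 2 - α * x - β = (x - μm) * (x - μp)) (hml : μm < lam) (hlp : lam < μp)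
    (t : ℝ) (k : Wave) :
    stream (u t) k = stream (eigProj μp (u t)) k + stream (eigProj μm (u t)) k
      + (γ / ((lam - μm) * (lam - μp)) : ℝ) * stream g k := by
  rw [stream_eigProj, stream_eigProj]
  have hc := hu.chain_stream t k
  rw [hp] at hc
  by_cases hk : normSq k = lam
  · rw [if_neg (by rw [hk]; exact hlp.ne), if_neg (by rw [hk]; exact hml.ne')]
    rw [hk] at hc
    have h1 : ((lam - μm) * (lam - μp) : ℂ) ≠ 0 := by
      exact_mod_cast mul_ne_zero (sub_ne_zero.2 hml.ne') (sub_ne_zero.2 hlp.ne)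
    push_cast at hc ⊢
    rw [zero_add, zero_add, div_mul_eq_mul_div, eq_div_iff h1]
    linear_combination hc
  · rw [(normSq_eq_or_stream_eq_zero hAg k).resolve_left hk] at hc ⊢
    by_cases h1 : normSq k = μp
    · rw [if_pos h1, if_neg (by linarith)]; simp
    · by_cases h2 : normSq k = μm
      · rw [if_neg h1, if_pos h2]; simp
      · rw [if_neg h1, if_neg h2]
        rw [mul_zero, mul_eq_zero] at hc
        rw [hc.resolve_left (by
          exact_mod_cast mul_ne_zero (sub_ne_zero.2 h2) (sub_ne_zero.2 h1))]
        simp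

open Classical in
/-- Weighted sums over a field with components at `μm`, `μp` and `lam` only. -/
theorem sum_weight_decomp {g : H} {hg : g ∈ stokes.domain} {lam : ℝ}
    (hAg : stokes ⟨g, hg⟩ = lam • g) {v : H} {μm μp κ : ℝ} (hml : μm < lam) (hlp : lam < μp)
    (hdec : ∀ k, stream v k = stream (eigProj μp v) k + stream (eigProj μm v) k + κ * stream g k)
    (S : Finset Wave) (f : ℝ → ℝ) :
    ∑ k ∈ S, f (normSq k) * (normSq k * ‖stream v k‖ ^ 2)
      = f μp * ∑ k ∈ S, normSq k * ‖stream (eigProj μp v) k‖ ^ 2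
        + f μm * ∑ k ∈ S, normSq k * ‖stream (eigProj μm v) k‖ ^ 2
        + f lam * (κ ^ 2 * ∑ k ∈ S, normSq k * ‖stream g k‖ ^ 2) := by
  rw [Finset.mul_sum, Finset.mul_sum, Finset.mul_sum, Finset.mul_sum, ← Finset.sum_add_distrib,
    ← Finset.sum_add_distrib]
  refine Finset.sum_congr rfl fun k _ => ?_
  have hd := hdec k
  rw [stream_eigProj, stream_eigProj] at hd ⊢
  by_cases hk : normSq k = lam
  · have h1 : normSq k ≠ μp := by rw [hk]; exact hlp.ne
    have h2 : normSq k ≠ μm := by rw [hk]; exact hml.ne'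
    rw [if_neg h1, if_neg h2] at hd ⊢
    rw [hd, hk, zero_add, zero_add, norm_mul, mul_pow, Complex.norm_real, Real.norm_eq_abs,
      sq_abs, norm_zero]
    ring
  · rw [(normSq_eq_or_stream_eq_zero hAg k).resolve_left hk] at hd ⊢
    by_cases h1 : normSq k = μp
    · have h2 : normSq k ≠ μm := by linarith
      rw [if_pos h1, if_neg h2, h1, norm_zero]; ring
    · by_cases h2 : normSq k = μm
      · rw [if_neg h1, if_pos h2, h2, norm_zero]; ring
      · rw [if_neg h1, if_neg h2] at hd ⊢
        rw [hd]; simp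

theorem hNorm_sq_pos {g : H} (hg0 : g ≠ 0) (S : Finset Wave) (h0 : (0 : Wave) ∉ S)
    (hgS : ∀ k ∉ S, stream g k = 0) : 0 < hNorm g ^ 2 := by
  obtain ⟨k, hk⟩ := exists_stream_ne_zero_of_ne_zero hg0
  have hkS : k ∈ S := by
    by_contra h
    exact hk (hgS k h)
  rw [hNorm_sq_eq_sum g S hgS]
  refine mul_pos (by positivity) (Finset.sum_pos' (fun k _ =>
    mul_nonneg (normSq_nonneg k) (sq_nonneg _)) ⟨k, hkS, ?_⟩)
  exact mul_pos (normSq_pos (ne_of_mem_of_not_mem hkS h0)) (by positivity)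

/-- The energy balance gives ‖u‖² = (g, u), and g pairs only with the λ-component κg of u. -/
theorem IsGhost.vNorm_sq_eq {g : H} {hg : g ∈ stokes.domain} {lam : ℝ}
    (hAg : stokes ⟨g, hg⟩ = lam • g) {u : ℝ → H} (hu : IsGhost g u) {μm μp κ : ℝ}
    (hml : μm < lam) (hlp : lam < μp) (S : Finset Wave) (h0 : (0 : Wave) ∉ S)
    (hneg : ∀ k ∈ S, -k ∈ S) (huS : ∀ t, ∀ k ∉ S, stream (u t) k = 0)
    (hgS : ∀ k ∉ S, stream g k = 0) (t : ℝ)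
    (hdec : ∀ k, stream (u t) k =
      stream (eigProj μp (u t)) k + stream (eigProj μm (u t)) k + κ * stream g k) :
    vNorm ⟨u t, stokes_domain_le (hu.sol.mem_domain t)⟩ ^ 2 = κ * hNorm g ^ 2 := by
  classical
  rw [vNorm_sq_eq_sum ⟨u t, _⟩ S (huS t), ← hu.energy_balance S h0 hneg huS,
    hNorm_sq_eq_sum g S hgS, mul_left_comm]
  congr 1
  rw [Finset.mul_sum]
  refine Finset.sum_congr rfl fun k _ => ?_
  rcases normSq_eq_or_stream_eq_zero hAg k with h | h
  · have hd := hdec k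
    rw [stream_eigProj, stream_eigProj, h, if_neg hlp.ne, if_neg hml.ne', zero_add,
      zero_add] at hd
    rw [hd, map_mul, Complex.conj_ofReal, mul_left_comm, Complex.mul_conj,
      Complex.re_ofReal_mul, Complex.ofReal_re, Complex.normSq_eq_norm_sq]
    ring
  · rw [h]; simp

/-- Apply the splitting with f(q) = q for the enstrophy and with f(q) = q(q - λ) for |Au|² - λ‖u‖²;
the second weight annihilates the component along g. -/
theorem amplitude_relations {v g : H} {μm μp lam κ : ℝ} (S : Finset Wave)
    (hvS : ∀ k ∉ S, stream v k = 0) (hgS : ∀ k ∉ S, stream g k = 0)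
    (hsplit : ∀ f : ℝ → ℝ, ∑ k ∈ S, f (normSq k) * (normSq k * ‖stream v k‖ ^ 2)
      = f μp * ∑ k ∈ S, normSq k * ‖stream (eigProj μp v) k‖ ^ 2
        + f μm * ∑ k ∈ S, normSq k * ‖stream (eigProj μm v) k‖ ^ 2
        + f lam * (κ ^ 2 * ∑ k ∈ S, normSq k * ‖stream g k‖ ^ 2))
    (hpal : ∑ k ∈ S, normSq k ^ 3 * ‖stream v k‖ ^ 2
      = lam * ∑ k ∈ S, normSq k ^ 2 * ‖stream v k‖ ^ 2) :
    (2 * Real.pi) ^ 2 * ∑ k ∈ S, normSq k ^ 2 * ‖stream v k‖ ^ 2 =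
        μp * hNorm (eigProj μp v) ^ 2 + μm * hNorm (eigProj μm v) ^ 2
          + lam * (κ ^ 2 * hNorm g ^ 2) ∧
      μp * (μp - lam) * hNorm (eigProj μp v) ^ 2
        + μm * (μm - lam) * hNorm (eigProj μm v) ^ 2 = 0 := by
  classical
  have hproj : ∀ μ, hNorm (eigProj μ v) ^ 2 = (2 * Real.pi) ^ 2 *
      ∑ k ∈ S, normSq k * ‖stream (eigProj μ v) k‖ ^ 2 := fun μ =>
    hNorm_sq_eq_sum _ S fun k hk => by rw [stream_eigProj, hvS k hk, ite_self]
  constructor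
  · have h := hsplit id
    simp only [id] at h
    have h' : ∑ k ∈ S, normSq k ^ 2 * ‖stream v k‖ ^ 2
        = ∑ k ∈ S, normSq k * (normSq k * ‖stream v k‖ ^ 2) :=
      Finset.sum_congr rfl fun k _ => by ring
    rw [h', h, hproj, hproj, hNorm_sq_eq_sum g S hgS]
    ring
  · have h := hsplit fun q => q * (q - lam)
    have h' : ∑ k ∈ S, normSq k * (normSq k - lam) * (normSq k * ‖stream v k‖ ^ 2) = 0 := by
      rw [← sub_eq_zero.2 hpal, Finset.mul_sum, ← Finset.sum_sub_distrib]
      exact Finset.sum_congr rfl fun k _ => by ring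
    rw [hproj, hproj]
    linear_combination (2 * Real.pi) ^ 2 * (h' - h)

end NSE

/-! ### Assembly of the theorem -/

open NSE in
theorem mainTheorem2 (g : NSE.H) (hg : g ∈ NSE.stokes.domain) (hg0 : g ≠ 0) (lam : ℝ)
    (hlam : 1 < lam) (hAg : NSE.stokes ⟨g, hg⟩ = lam • g)
    (u : ℝ → NSE.H) (α β γ : ℝ) (hu : NSE.IsChainedGhost g u α β γ) :
    ∃ μm μp E P : ℝ,
      (∀ x : ℝ, x ^ 2 - α * x - β = 0 ↔ x = μm ∨ x = μp) ∧
      NSE.IsEigenvalue μm ∧ NSE.IsEigenvalue μp ∧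
      μm < lam ∧ lam < μp ∧
      (∀ t, NSE.vNorm ⟨u t, NSE.stokes_domain_le (hu.ghost.sol.mem_domain t)⟩ ^ 2 = E) ∧
      (∀ t, NSE.hNorm (NSE.stokes ⟨u t, hu.ghost.sol.mem_domain t⟩) ^ 2 = P) ∧
      ∀ t,
        (∃ h : NSE.eigProj μp (u t) ∈ NSE.stokes.domain,
          NSE.stokes ⟨NSE.eigProj μp (u t), h⟩ = μp • NSE.eigProj μp (u t)) ∧
        (∃ h : NSE.eigProj μm (u t) ∈ NSE.stokes.domain,
          NSE.stokes ⟨NSE.eigProj μm (u t), h⟩ = μm • NSE.eigProj μm (u t)) ∧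
        u t = NSE.eigProj μp (u t) + NSE.eigProj μm (u t) + (E / NSE.hNorm g ^ 2) • g ∧
        NSE.hNorm (NSE.eigProj μp (u t)) ^ 2 =
          (lam - μm) / (μp * (μp - μm)) * E * (1 - P / NSE.hNorm g ^ 2) ∧
        NSE.hNorm (NSE.eigProj μm (u t)) ^ 2 =
          (lam - μp) / (μm * (μm - μp)) * E * (1 - P / NSE.hNorm g ^ 2) := by
  obtain ⟨S, hS⟩ := exists_modes α β lam
  have h0 : (0 : Wave) ∉ S := fun h => ((hS 0).1 h).1 rfl
  have hneg : ∀ k ∈ S, -k ∈ S := fun k hk => by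
    rw [hS] at hk ⊢
    rwa [normSq_neg, neg_ne_zero]
  have huS : ∀ t, ∀ k ∉ S, stream (u t) k = 0 := by
    intro t k hk
    by_contra h
    refine hk ((hS k).2 ⟨?_, ?_⟩)
    · rintro rfl
      exact h (stream_zero_wave _)
    · by_cases hkl : normSq k = lam
      · exact Or.inr hkl
      · exact Or.inl (hu.root_of_stream_ne_zero hAg h hkl)
  have hgS : ∀ k ∉ S, stream g k = 0 := by
    intro k hk
    by_contra h
    refine hk ((hS k).2 ⟨?_, Or.inr ((normSq_eq_or_stream_eq_zero hAg k).resolve_right h)⟩)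
    rintro rfl
    exact h (stream_zero_wave _)
  obtain ⟨t₀, km, kp, hkm, hkp, hml, hlp⟩ :=
    hu.exists_modes_lt_gt (zero_lt_one.trans hlam) hAg h0 hneg huS
  have hrm := hu.root_of_stream_ne_zero hAg hkm hml.ne
  have hrp := hu.root_of_stream_ne_zero hAg hkp hlp.ne'
  have hm0 : 0 < normSq km := normSq_pos fun h => hkm (by rw [h, stream_zero_wave])
  have hem := isEigenvalue_of_stream_ne_zero hkm
  have hep := isEigenvalue_of_stream_ne_zero hkp
  generalize normSq km = μm at *
  generalize normSq kp = μp at *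
  -- Vieta's formulas, by subtracting the equations of the two known distinct roots.
  have hα : α = μm + μp := by
    have h : μp - μm ≠ 0 := by linarith
    refine mul_left_cancel₀ h ?_
    linear_combination hrm - hrp
  have hβ : β = -(μm * μp) := by
    rw [hα] at hrm
    linear_combination -hrm
  have hp : ∀ x : ℝ, x ^ 2 - α * x - β = (x - μm) * (x - μp) := fun x => by rw [hα, hβ]; ring
  have hdec := hu.stream_decomp hAg hp hml hlp
  generalize γ / ((lam - μm) * (lam - μp)) = κ at hdec
  have hGpos := hNorm_sq_pos hg0 S h0 hgS
  have hE : ∀ t, vNorm ⟨u t, stokes_domain_le (hu.ghost.sol.mem_domain t)⟩ ^ 2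
      = κ * hNorm g ^ 2 := fun t =>
    hu.ghost.vNorm_sq_eq hAg hml hlp S h0 hneg huS hgS t (hdec t)
  have hP : ∀ t, hNorm (stokes ⟨u t, hu.ghost.sol.mem_domain t⟩) ^ 2
      = lam * (κ * hNorm g ^ 2) := by
    intro t
    rw [← hE t, hNorm_stokes_sq_eq_sum ⟨u t, _⟩ S (huS t),
      vNorm_sq_eq_sum ⟨u t, _⟩ S (huS t), hu.ghost.palinstrophy_eq hAg S h0 hneg huS]
    ring
  -- The constants are E = κG² and P = λE, independent of time because κ is.
  refine ⟨μm, μp, κ * hNorm g ^ 2, lam * (κ * hNorm g ^ 2), fun x => ?_, hem, hep, hml, hlp, hE,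
    hP, fun t => ⟨stokes_eigProj μp (u t), stokes_eigProj μm (u t), ?_, ?_⟩⟩
  · rw [hp, mul_eq_zero, sub_eq_zero, sub_eq_zero]
  · rw [mul_div_cancel_right₀ _ hGpos.ne']
    exact ext_stream fun k => by rw [stream_add, stream_add, stream_smul, ← hdec]
  · obtain ⟨h1, h2⟩ := amplitude_relations S (huS t) hgS
      (sum_weight_decomp hAg hml hlp (hdec t) S) (hu.ghost.palinstrophy_eq hAg S h0 hneg huS t)
    rw [← vNorm_sq_eq_sum ⟨u t, stokes_domain_le (hu.ghost.sol.mem_domain t)⟩ S (huS t),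
      hE t] at h1
    refine amplitude_formula hm0 hml hlp ?_ h2
    -- Since P/G² = λκ, the product E(1 - P/G²) equals E - λκ²G², the enstrophy left after removing
    -- the component along g.
    have hX : lam * (κ * hNorm g ^ 2) / hNorm g ^ 2 = lam * κ := by
      rw [← mul_assoc, mul_div_cancel_right₀ _ hGpos.ne']
    rw [hX]
    linear_combination -h1
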